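/- Let $\mathcal X,\mathcal Y,\mathcal M_1,\mathcal M_2$ be finite sets, let $(X,Y)$ be drawn from $\mathcal X\times\mathcal Y$ according to a PMF $P_{X,Y}$, and let $\rho>0$. Write $\log$ for $\log_2$, $\wedge$ for minimum, $\vee$ for maximum, and $$H_{\alpha}(X|Y)=\frac{\alpha}{1-\alpha}\log\sum_{y\in\mathcal Y}\Bigl(\sum_{x\in\mathcal X}P_{X,Y}(x,y)^{\alpha}\Bigr)^{1/\alpha},\qquad \tilde\rho=\frac1{1+\rho}.$$ An encoder is a conditional PMF $\Pr[M_1=m_1,M_2=m_2\,|\,X=x,Y=y]$, defined for all $(x,y)\in\mathcal X\times\mathcal Y$, of a pair of hints $(M_1,M_2)\in\mathcal M_1\times\mathcal M_2$. Bob's ambiguity (list version) is $\mathscr A_B^{(\mathrm l)}(P_{X,Y})=\mathbb E\bigl[|\mathcal L^Y_{M_1,M_2}|^\rho\bigr]$, where $\mathcal L^y_{m_1,m_2}=\{x:\Pr[X=x\,|\,Y=y,M_1=m_1,M_2=m_2]>0\}$. Eve's ambiguity is $$\mathscr A_E(P_{X,Y})=\min_{G_1,G_2}\mathbb E\bigl[G_1(X|Y,M_1)^\rho\wedge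 G_2(X|Y,M_2)^\rho\bigr],$$ where the minimum is over guessing functions, i.e. for all $y$, $m_1$, $m_2$ the maps $G_1(\cdot|y,m_1)$ and $G_2(\cdot|y,m_2)$ are bijections from $\mathcal X$ onto $\{1,\dots,|\mathcal X|\}$. Direct part: if $|\mathcal M_1||\mathcal M_2|>\log|\mathcal X|+2$, then for every triple $(c_s,c_1,c_2)$ of positive integers satisfying $$c_s\le|\mathcal M_1|\wedge|\mathcal M_2|,\quad c_1\le\bigl\lfloor|\mathcal M_1|/c_s\bigr\rfloor,\quad c_2\le\bigl\lfloor|\mathcal M_2|/c_s\bigr\rfloor,\quad c_sc_1c_2>\log|\mathcal X|+2,$$ there is an encoder for which both $$\mathscr A_B^{(\mathrm l)}(P_{X,Y})<1+2^{\rho\left(H_{\tilde\rho}(X|Y)-\log(c_sc_1c_2-\log|\mathcal X|-2)+2\right)}$$ and $$\mathscr A_E(P_{X,Y})\ge(1+\ln|\mathcal X|)^{-\rho}\,2^{\rho\left(H_{\tilde\rho}(X|Y)-\log(c_1+c_2)\right)}.$$ Converse part: for every encoder, $$\mathscr A_B^{(\mathrm l)}(P_{X,Y})\ge 2^{\rho\left(H_{\tilde\rho}(X|Y)-\log(|\mathcal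 M_1||\mathcal M_2|)\right)}\vee1$$ and $$\mathscr A_E(P_{X,Y})\le\Bigl[\bigl(|\mathcal M_1|^\rho\wedge|\mathcal M_2|^\rho\bigr)\,\mathscr A_B^{(\mathrm l)}(P_{X,Y})\Bigr]\wedge 2^{\rho H_{\tilde\rho}(X|Y)}.$$ -/

import Mathlib

noncomputable section

namespace DistStorage

/-- A guessing order on the finite set `X`: the element `x` is the `((g x : ℕ) + 1)`-st guess. -/
abbrev GuessOrder (X : Type*) [Fintype X] : Type _ := X ≃ Fin (Fintype.card X)

/-- The number of guesses, in `{1, …, |X|}`, that the order `g` needs to reach `x`. -/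
def GuessOrder.num {X : Type*} [Fintype X] (g : GuessOrder X) (x : X) : ℕ := (g x : ℕ) + 1

/-- A stochastic encoder: for every `(x, y)` a probability mass function of the pair of hints. -/
abbrev Encoder (X Y M₁ M₂ : Type*) : Type _ := X → Y → PMF (M₁ × M₂)

/-- Conditional Rényi entropy in bits (Arimoto's version)
`H_α(X|Y) = α / (1 - α) * log₂ ∑_y (∑_x P(x,y)^α)^(1/α)`, for orders `α ∈ (0,1) ∪ (1,∞)`. -/
def condRenyiEntropy {X Y : Type*} [Fintype X] [Fintype Y] (P : PMF (X × Y)) (α : ℝ) : ℝ :=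
  α / (1 - α) * Real.logb 2 (∑ y : Y, (∑ x : X, (P (x, y)).toReal ^ α) ^ (1 / α))

section Ambiguity

variable {X Y M₁ M₂ : Type*} [Fintype X] [Fintype Y] [Fintype M₁] [Fintype M₂]

/-- The joint probability of `(X, Y, M₁, M₂) = (x, y, m₁, m₂)`. -/
def jointProb (P : PMF (X × Y)) (W : Encoder X Y M₁ M₂) (x : X) (y : Y) (m₁ : M₁) (m₂ : M₂) : ℝ :=
  (P (x, y)).toReal * (W x y (m₁, m₂)).toReal

/-- The expectation of `f(X, Y, M₁, M₂)`. -/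
def expect (P : PMF (X × Y)) (W : Encoder X Y M₁ M₂) (f : X → Y → M₁ → M₂ → ℝ) : ℝ :=
  ∑ x, ∑ y, ∑ m₁, ∑ m₂, jointProb P W x y m₁ m₂ * f x y m₁ m₂

/-- The posterior probability of `X = x` given `(Y, M₁, M₂) = (y, m₁, m₂)`. If the conditioning
event has probability zero, the value is `0`; no expectation depends on this convention. -/
def posterior (P : PMF (X × Y)) (W : Encoder X Y M₁ M₂) (y : Y) (m₁ : M₁) (m₂ : M₂) (x : X) : ℝ :=
  jointProb P W x y m₁ m₂ / ∑ x', jointProb P W x' y m₁ m₂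

/-- Bob's list: all `x` of positive posterior probability given `(y, m₁, m₂)`. -/
def bobList (P : PMF (X × Y)) (W : Encoder X Y M₁ M₂) (y : Y) (m₁ : M₁) (m₂ : M₂) : Finset X :=
  Finset.univ.filter fun x => 0 < posterior P W y m₁ m₂ x

/-- Bob's ambiguity in the list version: the `ρ`-th moment of the size of his list. -/
def bobListAmbiguity (P : PMF (X × Y)) (W : Encoder X Y M₁ M₂) (ρ : ℝ) : ℝ :=
  expect P W fun _ y m₁ m₂ => ((bobList P W y m₁ m₂).card : ℝ) ^ ρ

/-- The `ρ`-th moment of Eve's number of guesses when she uses the guessing functions `G₁` (on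
seeing `(Y, M₁)`) and `G₂` (on seeing `(Y, M₂)`), and the better hint is revealed to her. -/
def eveMoment (P : PMF (X × Y)) (W : Encoder X Y M₁ M₂) (ρ : ℝ)
    (G₁ : Y → M₁ → GuessOrder X) (G₂ : Y → M₂ → GuessOrder X) : ℝ :=
  expect P W fun x y m₁ m₂ =>
    min (((G₁ y m₁).num x : ℝ) ^ ρ) (((G₂ y m₂).num x : ℝ) ^ ρ)

/-- Eve's ambiguity: the minimum of `eveMoment` over all pairs of guessing functions (an infimum
over a finite nonempty set, hence attained: see `exists_eveMoment_eq`). -/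
def eveAmbiguity (P : PMF (X × Y)) (W : Encoder X Y M₁ M₂) (ρ : ℝ) : ℝ :=
  ⨅ G : (Y → M₁ → GuessOrder X) × (Y → M₂ → GuessOrder X), eveMoment P W ρ G.1 G.2

theorem exists_eveMoment_eq (P : PMF (X × Y)) (W : Encoder X Y M₁ M₂) (ρ : ℝ) :
    (∃ G₁ G₂, eveMoment P W ρ G₁ G₂ = eveAmbiguity P W ρ) ∧
      ∀ G₁ G₂, eveAmbiguity P W ρ ≤ eveMoment P W ρ G₁ G₂ := by
  have : Nonempty (GuessOrder X) := ⟨Fintype.equivFin X⟩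
  constructor
  · obtain ⟨G, hG⟩ := exists_eq_ciInf_of_finite
      (f := fun G : (Y → M₁ → GuessOrder X) × (Y → M₂ → GuessOrder X) => eveMoment P W ρ G.1 G.2)
    exact ⟨G.1, G.2, hG⟩
  · intro G₁ G₂
    exact ciInf_le (f := fun G : (Y → M₁ → GuessOrder X) × (Y → M₂ → GuessOrder X) =>
      eveMoment P W ρ G.1 G.2) (Set.finite_range _).bddBelow (G₁, G₂)

end Ambiguity

end DistStorage

end

noncomputable section

namespace DistStorage

open Finset

/-! All lower bounds on moments come from one Hölder inequality, `sum_rpow_rpow_le`: if ∑ 1/N ≤ C,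
then ∑ q N^ρ is at least (∑ q^(1/(1+ρ)))^(1+ρ) / C^ρ. With q = P(·,y), summing the numerator over y
gives 2^(ρH).

Converse. For Bob, N is the list size; each pair of hints contributes at most 1 to ∑ 1/N, so C =
|M₁||M₂|. Eve can ignore the hints and guess by decreasing probability, or use one hint and go
through Bob's possible lists, shortest first, which costs at most the number of values of the
missing hint times the length of the true list.

Direct part. For each y, x is mapped to a label (s, a, b) in a set of size c_s c₁ c₂ so that likely
x share their label with few others (`exists_map_list_moment_le`). The hints are (s + u, a) and (u,
b) with a uniform pad u (`padEncoder`). Together they determine the label, so Bob's list is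
contained in its fibre. Separately, each hides s: since 1/min ≤ sum of the two reciprocals, and each
guessing order has harmonic reciprocal sum at most 1 + ln|X|, Hölder applies with C = (c₁ + c₂)(1 +
ln|X|) (`sum_inv_min_num_le`). -/

/-- Hölder's inequality in the form used for guessing and list-size moments. -/
theorem sum_rpow_rpow_le {ι : Type*} (s : Finset ι) {ρ : ℝ} (hρ : 0 < ρ) (q N : ι → ℝ)
    (hq : ∀ i ∈ s, 0 ≤ q i) (hN : ∀ i ∈ s, 0 < N i) :
    (∑ i ∈ s, q i ^ (1 / (1 + ρ))) ^ (1 + ρ) ≤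
      (∑ i ∈ s, q i * N i ^ ρ) * (∑ i ∈ s, (N i)⁻¹) ^ ρ := by
  classical
  have h1 : (0 : ℝ) < 1 + ρ := by linarith
  -- Weights 1/N against the function N q^(1/(1+ρ)). Extension by zero off s supplies the
  -- nonnegativity required at every index.
  have key := Real.inner_le_weight_mul_Lp_of_nonneg s (p := 1 + ρ) (by linarith)
    (s.piecewise (fun i => (N i)⁻¹) 0) (s.piecewise (fun i => N i * q i ^ (1 / (1 + ρ))) 0)
    (fun i => by
      by_cases hi : i ∈ s
      · simpa [hi] using (hN i hi).le
      · simp [hi])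
    (fun i => by
      by_cases hi : i ∈ s
      · simpa [hi] using mul_nonneg (hN i hi).le (Real.rpow_nonneg (hq i hi) _)
      · simp [hi])
  have e1 : ∑ i ∈ s, s.piecewise (fun i => (N i)⁻¹) 0 i *
      s.piecewise (fun i => N i * q i ^ (1 / (1 + ρ))) 0 i = ∑ i ∈ s, q i ^ (1 / (1 + ρ)) := by
    refine sum_congr rfl fun i hi => ?_
    simp only [piecewise_eq_of_mem, hi]
    rw [inv_mul_cancel_left₀ (hN i hi).ne']
  have e2 : ∑ i ∈ s, s.piecewise (fun i => (N i)⁻¹) 0 i = ∑ i ∈ s, (N i)⁻¹ :=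
    sum_congr rfl fun i hi => by simp [hi]
  have e3 : ∑ i ∈ s, s.piecewise (fun i => (N i)⁻¹) 0 i *
      s.piecewise (fun i => N i * q i ^ (1 / (1 + ρ))) 0 i ^ (1 + ρ) =
        ∑ i ∈ s, q i * N i ^ ρ := by
    refine sum_congr rfl fun i hi => ?_
    simp only [piecewise_eq_of_mem, hi]
    rw [Real.mul_rpow (hN i hi).le (Real.rpow_nonneg (hq i hi) _), ← Real.rpow_mul (hq i hi),
      one_div_mul_cancel h1.ne', Real.rpow_one, Real.rpow_add (hN i hi), Real.rpow_one]
    field_simp [(hN i hi).ne']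
  rw [e1, e2, e3] at key
  have hA : 0 ≤ ∑ i ∈ s, (N i)⁻¹ := sum_nonneg fun i hi => (inv_pos.2 (hN i hi)).le
  have hB : 0 ≤ ∑ i ∈ s, q i * N i ^ ρ :=
    sum_nonneg fun i hi => mul_nonneg (hq i hi) (Real.rpow_nonneg (hN i hi).le _)
  refine (Real.rpow_le_rpow (sum_nonneg fun i hi => Real.rpow_nonneg (hq i hi) _) key
    h1.le).trans_eq ?_
  rw [Real.mul_rpow (Real.rpow_nonneg hA _) (Real.rpow_nonneg hB _), ← Real.rpow_mul hA,
    ← Real.rpow_mul hB, inv_mul_cancel₀ h1.ne', Real.rpow_one, mul_comm]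
  congr 2
  field_simp
  ring

/-- Subadditivity of `t ↦ t ^ a` for exponents in `(0, 1]`. -/
theorem rpow_sum_le_sum_rpow {ι : Type*} (s : Finset ι) {a : ℝ} (ha : 0 < a) (ha1 : a ≤ 1)
    (q : ι → ℝ) (hq : ∀ i, 0 ≤ q i) : (∑ i ∈ s, q i) ^ a ≤ ∑ i ∈ s, q i ^ a := by
  classical
  induction s using Finset.induction_on with
  | empty => simp [Real.zero_rpow ha.ne']
  | insert i s hi ih =>
    rw [sum_insert hi, sum_insert hi]
    exact (Real.rpow_add_le_add_rpow (hq i) (sum_nonneg fun j _ => hq j) ha.le ha1).trans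
      (by gcongr)

/-! ### Probability mass functions and Rényi entropy -/

theorem card_pos_of_pmf {X Y : Type*} [Fintype X] (P : PMF (X × Y)) : 0 < Fintype.card X := by
  obtain ⟨z, -⟩ := P.support_nonempty
  exact Fintype.card_pos_iff.2 ⟨z.1⟩

theorem sum_toReal_eq_one {Z : Type*} [Fintype Z] (p : PMF Z) : ∑ z, (p z).toReal = 1 := by
  rw [← ENNReal.toReal_sum fun z _ => p.apply_ne_top z, ← tsum_fintype (L := .unconditional _),
    p.tsum_coe, ENNReal.toReal_one]

theorem sum_sum_toReal_eq_one {A B : Type*} [Fintype A] [Fintype B] (p : PMF (A × B)) :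
    ∑ a, ∑ b, (p (a, b)).toReal = 1 := by
  rw [← sum_toReal_eq_one p, Fintype.sum_prod_type]

/-- `2 ^ (ρ H(X|Y))` for the order `1 / (1 + ρ)`, as a sum over the side information. -/
def renyiSum {X Y : Type*} [Fintype X] [Fintype Y] (P : PMF (X × Y)) (ρ : ℝ) : ℝ :=
  ∑ y : Y, (∑ x : X, (P (x, y)).toReal ^ (1 / (1 + ρ))) ^ (1 + ρ)

theorem renyiSum_pos {X Y : Type*} [Fintype X] [Fintype Y] (P : PMF (X × Y)) (ρ : ℝ) :
    0 < renyiSum P ρ := by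
  obtain ⟨⟨x, y⟩, hxy⟩ := P.support_nonempty
  have hpos : 0 < (P (x, y)).toReal :=
    ENNReal.toReal_pos ((P.mem_support_iff _).1 hxy) (P.apply_ne_top _)
  have hx : ∀ y x, 0 ≤ (P (x, y)).toReal ^ (1 / (1 + ρ)) := fun y x => by positivity
  refine sum_pos' (fun y _ => Real.rpow_nonneg (sum_nonneg fun x _ => hx y x) _)
    ⟨y, mem_univ _, Real.rpow_pos_of_pos ?_ _⟩
  exact sum_pos' (fun x _ => hx y x) ⟨x, mem_univ _, Real.rpow_pos_of_pos hpos _⟩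

theorem two_rpow_mul_condRenyiEntropy {X Y : Type*} [Fintype X] [Fintype Y] (P : PMF (X × Y))
    {ρ : ℝ} (hρ : 0 < ρ) :
    (2 : ℝ) ^ (ρ * condRenyiEntropy P (1 / (1 + ρ))) = renyiSum P ρ := by
  have h1 : (1 : ℝ) + ρ ≠ 0 := by linarith
  have : ρ * condRenyiEntropy P (1 / (1 + ρ)) = Real.logb 2 (renyiSum P ρ) := by
    unfold condRenyiEntropy renyiSum
    rw [← mul_assoc, one_div_one_div]
    have : ρ * (1 / (1 + ρ) / (1 - 1 / (1 + ρ))) = 1 := by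
      have : 1 - 1 / (1 + ρ) = ρ / (1 + ρ) := by field_simp; ring
      rw [this]
      field_simp
    rw [this, one_mul]
  rw [this, Real.rpow_logb two_pos (by norm_num) (renyiSum_pos P ρ)]

theorem two_rpow_mul_condRenyiEntropy_sub {X Y : Type*} [Fintype X] [Fintype Y] (P : PMF (X × Y))
    {ρ : ℝ} (hρ : 0 < ρ) {t : ℝ} (ht : 0 < t) :
    (2 : ℝ) ^ (ρ * (condRenyiEntropy P (1 / (1 + ρ)) - Real.logb 2 t)) =
      renyiSum P ρ / t ^ ρ := by
  rw [mul_sub, Real.rpow_sub two_pos, two_rpow_mul_condRenyiEntropy P hρ, mul_comm ρ (Real.logb _ _),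
    Real.rpow_mul two_pos.le, Real.rpow_logb two_pos (by norm_num) ht]

/-! ### Guessing orders -/

section GuessOrder

variable {X : Type*} [Fintype X]

theorem GuessOrder.one_le_num (g : GuessOrder X) (x : X) : 1 ≤ g.num x := Nat.le_add_left _ _

/-- Guess numbers run bijectively through 1, …, |X|, so the sum is a harmonic number. -/
theorem GuessOrder.sum_inv_num_le (g : GuessOrder X) :
    ∑ x, ((g.num x : ℝ))⁻¹ ≤ 1 + Real.log (Fintype.card X) := by
  have : ∑ x, ((g.num x : ℝ))⁻¹ = (harmonic (Fintype.card X) : ℝ) := by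
    rw [harmonic, ← Fin.sum_univ_eq_sum_range (fun i => ((i + 1 : ℕ) : ℚ)⁻¹)]
    push_cast
    rw [← Equiv.sum_comp g]
    simp [GuessOrder.num]
  rw [this]
  exact harmonic_le_one_add_log _

/-- Guessing in the order of increasing values of a key. -/
theorem exists_guessOrder_num_le {κ : Type*} [LinearOrder κ] (f : X → κ) :
    ∃ g : GuessOrder X, ∀ x, g.num x ≤ #{x' | f x' ≤ f x} := by
  classical
  let e := Fintype.equivFin X
  let σ := Tuple.sort (f ∘ e.symm)
  refine ⟨e.trans σ.symm, fun x => ?_⟩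
  have hm : Monotone (f ∘ e.symm ∘ σ) := Tuple.monotone_sort (f ∘ e.symm)
  set i := (e.trans σ.symm) x with hi
  have hx : e.symm (σ i) = x := by simp [hi]
  have : (Finset.Iic i).map (σ.trans e.symm).toEmbedding ⊆ ({x' | f x' ≤ f x} : Finset X) := by
    intro x' hx'
    obtain ⟨j, hj, rfl⟩ := Finset.mem_map.1 hx'
    have := hm (Finset.mem_Iic.1 hj)
    simp only [Function.comp_apply, hx] at this
    simpa using this
  have h := card_le_card this
  rw [card_map, Fin.card_Iic] at h
  exact h

/-- If a hint `m` with list `L m` is withheld, one can guess so that every element of every list is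
found within `card M * #(L m)` guesses. -/
theorem exists_guessOrder_num_le_mul_card {M : Type*} [Fintype M] (L : M → Finset X) :
    ∃ g : GuessOrder X, ∀ m, ∀ x ∈ L m, g.num x ≤ Fintype.card M * #(L m) := by
  classical
  -- The key is the size of the smallest list containing x, and ⊤ if no list does.
  let f : X → ℕ∞ := fun x => univ.inf fun m => if x ∈ L m then (#(L m) : ℕ∞) else ⊤
  obtain ⟨g, hg⟩ := exists_guessOrder_num_le f
  refine ⟨g, fun m x hx => (hg x).trans ?_⟩
  have hfx : f x ≤ #(L m) := (Finset.inf_le (mem_univ m)).trans (by simp [hx])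
  -- Whatever precedes or ties with x lies in some list no longer than `L m`.
  have hsub : ({x' | f x' ≤ f x} : Finset X) ⊆
      ({m' | #(L m') ≤ #(L m)} : Finset M).biUnion L := by
    intro x' hx'
    have hx' : f x' ≤ #(L m) := (by simpa using hx' : f x' ≤ f x).trans hfx
    obtain ⟨m', -, hm'⟩ := exists_mem_eq_inf (univ : Finset M) ⟨m, mem_univ m⟩
      fun m => if x' ∈ L m then (#(L m) : ℕ∞) else ⊤
    change f x' = _ at hm'
    rw [hm'] at hx'
    split_ifs at hx' with hmem
    · exact mem_biUnion.2 ⟨m', by simpa using hx', hmem⟩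
    · simp at hx'
  calc _ ≤ #(({m' | #(L m') ≤ #(L m)} : Finset M).biUnion L) := card_le_card hsub
    _ ≤ #({m' | #(L m') ≤ #(L m)} : Finset M) * #(L m) :=
        card_biUnion_le_card_mul _ _ _ fun m' hm' => by simpa using hm'
    _ ≤ _ := Nat.mul_le_mul_right _ (card_le_univ _)

end GuessOrder

/-! ### Bob's list and its moments -/

theorem min_rpow {a b ρ : ℝ} (ha : 0 ≤ a) (hb : 0 ≤ b) (hρ : 0 ≤ ρ) :
    min (a ^ ρ) (b ^ ρ) = min a b ^ ρ := by
  rcases le_total a b with h | h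
  · rw [min_eq_left h, min_eq_left (Real.rpow_le_rpow ha h hρ)]
  · rw [min_eq_right h, min_eq_right (Real.rpow_le_rpow hb h hρ)]

theorem jointProb_nonneg {X Y M₁ M₂ : Type*} (P : PMF (X × Y)) (W : Encoder X Y M₁ M₂) (x : X)
    (y : Y) (m₁ : M₁) (m₂ : M₂) : 0 ≤ jointProb P W x y m₁ m₂ := by
  unfold jointProb
  positivity

theorem sum_jointProb {X Y M₁ M₂ : Type*} [Fintype M₁] [Fintype M₂] (P : PMF (X × Y))
    (W : Encoder X Y M₁ M₂) (x : X) (y : Y) :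
    ∑ m₁, ∑ m₂, jointProb P W x y m₁ m₂ = (P (x, y)).toReal := by
  simp_rw [jointProb, ← mul_sum, sum_sum_toReal_eq_one, mul_one]

theorem mem_bobList_iff {X Y M₁ M₂ : Type*} [Fintype X] (P : PMF (X × Y))
    (W : Encoder X Y M₁ M₂) (x : X) (y : Y) (m₁ : M₁) (m₂ : M₂) :
    x ∈ bobList P W y m₁ m₂ ↔ 0 < jointProb P W x y m₁ m₂ := by
  have hn := fun x => jointProb_nonneg P W x y m₁ m₂
  rw [bobList, mem_filter, and_iff_right (mem_univ x), posterior]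
  constructor
  · intro h
    refine (hn x).lt_of_ne' fun h0 => ?_
    simp [h0] at h
  · intro h
    exact div_pos h (sum_pos' (fun x _ => hn x) ⟨x, mem_univ _, h⟩)

theorem one_le_card_bobList {X Y M₁ M₂ : Type*} [Fintype X] {P : PMF (X × Y)}
    {W : Encoder X Y M₁ M₂} {x : X} {y : Y} {m₁ : M₁} {m₂ : M₂}
    (h : 0 < jointProb P W x y m₁ m₂) : 1 ≤ #(bobList P W y m₁ m₂) :=
  card_pos.2 ⟨x, (mem_bobList_iff P W x y m₁ m₂).2 h⟩

/-- Hölder over triples (x, m₁, m₂): splitting P(x,y) among the hints can only increase the sum of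
1/(1+ρ)-th powers, by subadditivity. -/
theorem sum_rpow_le_bobList_moment {X Y M₁ M₂ : Type*} [Fintype X] [Fintype M₁] [Fintype M₂]
    (P : PMF (X × Y)) (W : Encoder X Y M₁ M₂) {ρ : ℝ} (hρ : 0 < ρ) (y : Y) :
    (∑ x, (P (x, y)).toReal ^ (1 / (1 + ρ))) ^ (1 + ρ) ≤
      (∑ x, ∑ m₁, ∑ m₂, jointProb P W x y m₁ m₂ * (#(bobList P W y m₁ m₂) : ℝ) ^ ρ) *
        ((Fintype.card M₁ : ℝ) * Fintype.card M₂) ^ ρ := by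
  classical
  let q : X × M₁ × M₂ → ℝ := fun z => jointProb P W z.1 y z.2.1 z.2.2
  let N : X × M₁ × M₂ → ℝ := fun z => #(bobList P W y z.2.1 z.2.2)
  have hq : ∀ z, 0 ≤ q z := fun z => jointProb_nonneg P W _ _ _ _
  have h1 : (0 : ℝ) < 1 + ρ := by linarith
  have ha : (0 : ℝ) < 1 / (1 + ρ) := by positivity
  have ha1 : 1 / (1 + ρ) ≤ 1 := by rw [div_le_one h1]; linarith
  -- Only on the support is the list guaranteed nonempty, hence N positive.
  let s : Finset (X × M₁ × M₂) := {z | 0 < q z}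
  have hs : ∀ z, z ∉ s → q z = 0 := fun z hz =>
    le_antisymm (not_lt.1 fun h => hz (by simpa [s] using h)) (hq z)
  have key := sum_rpow_rpow_le s hρ q N (fun z _ => hq z) fun z hz => by
    have : 0 < q z := by simpa [s] using hz
    exact Nat.cast_pos.2 (one_le_card_bobList this)
  have e1 : ∑ x, (P (x, y)).toReal ^ (1 / (1 + ρ)) ≤ ∑ z ∈ s, q z ^ (1 / (1 + ρ)) := by
    rw [sum_subset (subset_univ s) fun z _ hz => by rw [hs z hz, Real.zero_rpow ha.ne'],
      Fintype.sum_prod_type]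
    refine sum_le_sum fun x _ => ?_
    rw [← sum_jointProb P W, ← Fintype.sum_prod_type']
    exact rpow_sum_le_sum_rpow _ ha ha1 (fun m => q (x, m)) fun m => hq _
  have e2 : ∑ z ∈ s, q z * N z ^ ρ =
      ∑ x, ∑ m₁, ∑ m₂, jointProb P W x y m₁ m₂ * (#(bobList P W y m₁ m₂) : ℝ) ^ ρ := by
    rw [sum_subset (subset_univ s) fun z _ hz => by rw [hs z hz, zero_mul],
      Fintype.sum_prod_type]
    exact sum_congr rfl fun x _ => Fintype.sum_prod_type _
  -- For fixed hints the members of the list each contribute 1/(list size): 1 in total, or 0 for an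
  -- empty list.
  have e3 : ∑ z ∈ s, (N z)⁻¹ ≤ (Fintype.card M₁ : ℝ) * Fintype.card M₂ := by
    rw [sum_filter, Fintype.sum_prod_type_right]
    have : ∀ m : M₁ × M₂, ∑ x, (if 0 < q (x, m) then (N (x, m))⁻¹ else 0) ≤ 1 := by
      intro m
      have hc : ∀ x, 0 < q (x, m) ↔ x ∈ bobList P W y m.1 m.2 :=
        fun x => (mem_bobList_iff P W x y m.1 m.2).symm
      simp only [hc, N]
      rw [← sum_filter, sum_const, nsmul_eq_mul, filter_mem_eq_inter, univ_inter]
      exact mul_inv_le_one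
    refine (sum_le_sum fun m _ => this m).trans ?_
    simp
  rw [← e2]
  refine (Real.rpow_le_rpow (sum_nonneg fun x _ => by positivity) e1 h1.le).trans (key.trans ?_)
  refine mul_le_mul_of_nonneg_left (Real.rpow_le_rpow ?_ e3 hρ.le) ?_
  · exact sum_nonneg fun z _ => inv_nonneg.2 (Nat.cast_nonneg _)
  · exact sum_nonneg fun z _ => mul_nonneg (hq z) (Real.rpow_nonneg (Nat.cast_nonneg _) _)

/-! ### Converse part -/

section Converse

variable {X Y M₁ M₂ : Type*} [Fintype X] [Fintype Y] [Fintype M₁] [Fintype M₂]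

theorem expect_mono (P : PMF (X × Y)) (W : Encoder X Y M₁ M₂) {f g : X → Y → M₁ → M₂ → ℝ}
    (h : ∀ x y m₁ m₂, 0 < jointProb P W x y m₁ m₂ → f x y m₁ m₂ ≤ g x y m₁ m₂) :
    expect P W f ≤ expect P W g := by
  refine sum_le_sum fun x _ => sum_le_sum fun y _ => sum_le_sum fun m₁ _ => sum_le_sum fun m₂ _ => ?_
  rcases (jointProb_nonneg P W x y m₁ m₂).eq_or_lt with h0 | h0
  · simp [← h0]
  · exact mul_le_mul_of_nonneg_left (h x y m₁ m₂ h0) h0.le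

theorem expect_const_mul (P : PMF (X × Y)) (W : Encoder X Y M₁ M₂) (c : ℝ)
    (f : X → Y → M₁ → M₂ → ℝ) :
    (expect P W fun x y m₁ m₂ => c * f x y m₁ m₂) = c * expect P W f := by
  simp_rw [expect, mul_sum, mul_left_comm]

theorem expect_of_source (P : PMF (X × Y)) (W : Encoder X Y M₁ M₂) (f : X → Y → ℝ) :
    (expect P W fun x y _ _ => f x y) = ∑ x, ∑ y, (P (x, y)).toReal * f x y := by
  simp_rw [expect, ← sum_mul, sum_jointProb]

theorem one_le_bobListAmbiguity (P : PMF (X × Y)) (W : Encoder X Y M₁ M₂) {ρ : ℝ} (hρ : 0 < ρ) :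
    1 ≤ bobListAmbiguity P W ρ := by
  have : (expect P W fun _ _ _ _ => (1 : ℝ)) = 1 := by
    rw [expect_of_source P W fun _ _ => 1]
    simp_rw [mul_one, sum_sum_toReal_eq_one]
  rw [← this]
  exact expect_mono P W fun x y m₁ m₂ h =>
    Real.one_le_rpow (by exact_mod_cast one_le_card_bobList h) hρ.le

theorem renyiSum_le_bobListAmbiguity_mul (P : PMF (X × Y)) (W : Encoder X Y M₁ M₂) {ρ : ℝ}
    (hρ : 0 < ρ) :
    renyiSum P ρ ≤ bobListAmbiguity P W ρ * ((Fintype.card M₁ : ℝ) * Fintype.card M₂) ^ ρ := by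
  rw [bobListAmbiguity, expect, sum_comm, sum_mul]
  exact sum_le_sum fun y _ => sum_rpow_le_bobList_moment P W hρ y

theorem eveAmbiguity_le (P : PMF (X × Y)) (W : Encoder X Y M₁ M₂) (ρ : ℝ)
    (G₁ : Y → M₁ → GuessOrder X) (G₂ : Y → M₂ → GuessOrder X) :
    eveAmbiguity P W ρ ≤ eveMoment P W ρ G₁ G₂ := (exists_eveMoment_eq P W ρ).2 G₁ G₂

/-- Seeing m₁ alone leaves |M₂| candidate lists; the second guessing order is irrelevant, as the
minimum is bounded by the first count. -/
theorem eveAmbiguity_le_card_right_mul (P : PMF (X × Y)) (W : Encoder X Y M₁ M₂) {ρ : ℝ}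
    (hρ : 0 < ρ) :
    eveAmbiguity P W ρ ≤ (Fintype.card M₂ : ℝ) ^ ρ * bobListAmbiguity P W ρ := by
  choose G hG using fun y m₁ => exists_guessOrder_num_le_mul_card fun m₂ => bobList P W y m₁ m₂
  refine (eveAmbiguity_le P W ρ G fun _ _ => Fintype.equivFin X).trans ?_
  rw [bobListAmbiguity, ← expect_const_mul]
  refine expect_mono P W fun x y m₁ m₂ h => (min_le_left _ _).trans ?_
  rw [← Real.mul_rpow (Nat.cast_nonneg _) (Nat.cast_nonneg _)]
  refine Real.rpow_le_rpow (Nat.cast_nonneg _) ?_ hρ.le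
  exact_mod_cast hG y m₁ m₂ x ((mem_bobList_iff P W x y m₁ m₂).2 h)

theorem eveAmbiguity_le_card_left_mul (P : PMF (X × Y)) (W : Encoder X Y M₁ M₂) {ρ : ℝ}
    (hρ : 0 < ρ) :
    eveAmbiguity P W ρ ≤ (Fintype.card M₁ : ℝ) ^ ρ * bobListAmbiguity P W ρ := by
  choose G hG using fun y m₂ => exists_guessOrder_num_le_mul_card fun m₁ => bobList P W y m₁ m₂
  refine (eveAmbiguity_le P W ρ (fun _ _ => Fintype.equivFin X) G).trans ?_
  rw [bobListAmbiguity, ← expect_const_mul]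
  refine expect_mono P W fun x y m₁ m₂ h => (min_le_right _ _).trans ?_
  rw [← Real.mul_rpow (Nat.cast_nonneg _) (Nat.cast_nonneg _)]
  refine Real.rpow_le_rpow (Nat.cast_nonneg _) ?_ hρ.le
  exact_mod_cast hG y m₂ m₁ x ((mem_bobList_iff P W x y m₁ m₂).2 h)

/-- Arikan's bound: guessing in decreasing order of probability. -/
theorem exists_guessOrder_moment_le (p : X → ℝ) (hp : ∀ x, 0 ≤ p x) {ρ : ℝ} (hρ : 0 < ρ) :
    ∃ g : GuessOrder X, ∑ x, p x * (g.num x : ℝ) ^ ρ ≤ (∑ x, p x ^ (1 / (1 + ρ))) ^ (1 + ρ) := by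
  classical
  have h1 : (0 : ℝ) < 1 + ρ := by linarith
  set a := 1 / (1 + ρ) with ha
  have ha0 : 0 < a := by positivity
  have hpa : ∀ x, 0 ≤ p x ^ a := fun x => Real.rpow_nonneg (hp x) _
  set A := ∑ x, p x ^ a
  have hA : 0 ≤ A := sum_nonneg fun x _ => hpa x
  obtain ⟨g, hg⟩ := exists_guessOrder_num_le fun x => -p x
  refine ⟨g, ?_⟩
  have hterm : ∀ x, p x * (g.num x : ℝ) ^ ρ ≤ p x ^ a * A ^ ρ := by
    intro x
    rcases (hp x).eq_or_lt with h0 | h0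
    · rw [← h0, zero_mul, Real.zero_rpow ha0.ne', zero_mul]
    -- Everything guessed up to x is at least as likely as x, so these terms already sum to at least
    -- the left side.
    have hnum : p x ^ a * (g.num x : ℝ) ≤ A := by
      calc p x ^ a * (g.num x : ℝ) ≤ p x ^ a * #{x' | -p x' ≤ -p x} := by
            gcongr
            exact hg x
        _ = ∑ x' with -p x' ≤ -p x, p x ^ a := by
            rw [sum_const, nsmul_eq_mul, mul_comm]
        _ ≤ ∑ x' with -p x' ≤ -p x, p x' ^ a := by
            refine sum_le_sum fun x' hx' => Real.rpow_le_rpow h0.le ?_ ha0.le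
            simpa using hx'
        _ ≤ A := sum_le_sum_of_subset_of_nonneg (subset_univ _) fun x _ _ => hpa x
    have hsplit : p x = p x ^ a * (p x ^ a) ^ ρ := by
      rw [← Real.rpow_mul h0.le, ← Real.rpow_add h0]
      have : a + a * ρ = 1 := by rw [ha]; field_simp
      rw [this, Real.rpow_one]
    calc p x * (g.num x : ℝ) ^ ρ = p x ^ a * (p x ^ a * g.num x) ^ ρ := by
          rw [Real.mul_rpow (hpa x) (Nat.cast_nonneg _), ← mul_assoc, ← hsplit]
      _ ≤ p x ^ a * A ^ ρ := by
          refine mul_le_mul_of_nonneg_left (Real.rpow_le_rpow ?_ hnum hρ.le) (hpa x)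
          exact mul_nonneg (hpa x) (Nat.cast_nonneg _)
  refine (sum_le_sum fun x _ => hterm x).trans_eq ?_
  rw [← sum_mul, Real.rpow_add_of_nonneg hA zero_le_one hρ.le, Real.rpow_one]

theorem eveAmbiguity_le_renyiSum (P : PMF (X × Y)) (W : Encoder X Y M₁ M₂) {ρ : ℝ} (hρ : 0 < ρ) :
    eveAmbiguity P W ρ ≤ renyiSum P ρ := by
  choose G hG using fun y => exists_guessOrder_moment_le (fun x => (P (x, y)).toReal)
    (fun _ => ENNReal.toReal_nonneg) hρ
  refine (eveAmbiguity_le P W ρ (fun y _ => G y) fun y _ => G y).trans ?_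
  simp_rw [eveMoment, min_self]
  rw [expect_of_source P W fun x y => ((G y).num x : ℝ) ^ ρ, sum_comm]
  exact sum_le_sum fun y _ => hG y

theorem converse_bound (P : PMF (X × Y)) {ρ : ℝ} (hρ : 0 < ρ) (W : Encoder X Y M₁ M₂) :
    max ((2 : ℝ) ^ (ρ * (condRenyiEntropy P (1 / (1 + ρ))
          - Real.logb 2 ((Fintype.card M₁ : ℝ) * (Fintype.card M₂ : ℝ))))) 1
        ≤ bobListAmbiguity P W ρ ∧
      eveAmbiguity P W ρ ≤
        min (min ((Fintype.card M₁ : ℝ) ^ ρ) ((Fintype.card M₂ : ℝ) ^ ρ)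
            * bobListAmbiguity P W ρ)
          ((2 : ℝ) ^ (ρ * condRenyiEntropy P (1 / (1 + ρ)))) := by
  obtain ⟨⟨x, y⟩, -⟩ := P.support_nonempty
  obtain ⟨⟨m₁, m₂⟩, -⟩ := (W x y).support_nonempty
  have hM₁ : 0 < Fintype.card M₁ := Fintype.card_pos_iff.2 ⟨m₁⟩
  have hM₂ : 0 < Fintype.card M₂ := Fintype.card_pos_iff.2 ⟨m₂⟩
  have hK : (0 : ℝ) < (Fintype.card M₁ : ℝ) * Fintype.card M₂ := by positivity
  refine ⟨max_le ?_ (one_le_bobListAmbiguity P W hρ), le_min ?_ ?_⟩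
  · rw [two_rpow_mul_condRenyiEntropy_sub P hρ hK, div_le_iff₀ (Real.rpow_pos_of_pos hK _)]
    exact renyiSum_le_bobListAmbiguity_mul P W hρ
  · rcases min_choice ((Fintype.card M₁ : ℝ) ^ ρ) ((Fintype.card M₂ : ℝ) ^ ρ) with h | h <;> rw [h]
    · exact eveAmbiguity_le_card_left_mul P W hρ
    · exact eveAmbiguity_le_card_right_mul P W hρ
  · rw [two_rpow_mul_condRenyiEntropy P hρ]
    exact eveAmbiguity_le_renyiSum P W hρ

end Converse

/-! ### Labelling with short lists for likely elements -/

/-- A finite set with a level for each element can be split so that the part of `x` has at most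
`2 ^ ℓ x` elements; the number of parts needed is controlled by `∑ 2 ^ (-ℓ x)`. -/
theorem exists_map_card_fiber_le {X Z : Type*} [Fintype X] [Fintype Z] [DecidableEq Z] (J : ℕ)
    (ℓ : X → ℕ) (hℓ : ∀ x, ℓ x ≤ J) (hJ : Fintype.card X ≤ 2 ^ J)
    (hZ : (∑ x with ℓ x < J, ((2 : ℝ) ^ ℓ x)⁻¹) + J + 1 ≤ Fintype.card Z) :
    ∃ f : X → Z, ∀ x, #{x' | f x' = f x} ≤ 2 ^ ℓ x := by
  classical
  let n : ℕ → ℕ := fun j => #{x | ℓ x = j}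
  let e : ∀ j, {x // x ∈ ({x | ℓ x = j} : Finset X)} ≃ Fin (n j) := fun j => Finset.equivFin _
  -- Rank of x within its level; level j is cut into blocks of 2^j consecutive ranks.
  let R : ℕ → X → ℕ := fun j x => if h : ℓ x = j then (e j ⟨x, by simpa using h⟩ : ℕ) else 0
  have hR : ∀ x, R (ℓ x) x < n (ℓ x) := fun x => by simp [R]
  have hRinj : ∀ j x x', ℓ x = j → ℓ x' = j → R j x = R j x' → x = x' := by
    intro j x x' h h' hxx
    simp only [R, h, h', dif_pos] at hxx
    simpa using (e j).injective (Fin.ext hxx)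
  -- Below J, rounding costs at most one extra block per level. Level J needs only one block because
  -- |X| ≤ 2^J.
  let c : ℕ → ℕ := fun j => if j < J then n j / 2 ^ j + 1 else 1
  let T : Finset (Σ _ : ℕ, ℕ) := (range (J + 1)).sigma fun j => range (c j)
  have hmem : ∀ x, (⟨ℓ x, R (ℓ x) x / 2 ^ ℓ x⟩ : Σ _ : ℕ, ℕ) ∈ T := by
    intro x
    refine mem_sigma.2 ⟨mem_range.2 (Nat.lt_succ_of_le (hℓ x)), mem_range.2 ?_⟩
    simp only [c]
    split_ifs with h
    · exact Nat.lt_succ_of_le (Nat.div_le_div_right (hR x).le)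
    · have : ℓ x = J := le_antisymm (hℓ x) (not_lt.1 h)
      rw [Nat.lt_one_iff, Nat.div_eq_zero_iff]
      refine Or.inr ((hR x).trans_le ((card_le_univ _).trans ?_))
      rwa [this]
  have hT : Fintype.card T ≤ Fintype.card Z := by
    rw [Fintype.card_coe, card_sigma]
    simp only [card_range]
    rw [sum_range_succ]
    have hcJ : c J = 1 := by simp [c]
    have hsum : ((∑ j ∈ range J, c j : ℕ) : ℝ) ≤ (∑ x with ℓ x < J, ((2 : ℝ) ^ ℓ x)⁻¹) + J := by
      have hfib : (∑ x with ℓ x < J, ((2 : ℝ) ^ ℓ x)⁻¹) =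
          ∑ j ∈ range J, (n j : ℝ) * ((2 : ℝ) ^ j)⁻¹ := by
        rw [← sum_fiberwise_of_maps_to (t := range J) (g := ℓ) fun x hx => by simpa using hx]
        refine sum_congr rfl fun j hj => ?_
        have hset : ({x ∈ ({x | ℓ x < J} : Finset X) | ℓ x = j}) = ({x | ℓ x = j} : Finset X) := by
          ext x
          have := mem_range.1 hj
          simp only [mem_filter, mem_univ, true_and]
          omega
        rw [hset, sum_congr rfl fun x hx => by rw [(mem_filter.1 hx).2], sum_const, nsmul_eq_mul]
      have hJsum : (J : ℝ) = ∑ j ∈ range J, (1 : ℝ) := by simp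
      rw [hfib, hJsum, ← sum_add_distrib, Nat.cast_sum]
      refine sum_le_sum fun j hj => ?_
      simp only [c, mem_range.1 hj, if_true]
      push_cast
      gcongr
      rw [← div_eq_mul_inv]
      exact_mod_cast Nat.cast_div_le (α := ℝ) (m := n j) (n := 2 ^ j)
    rw [hcJ]
    have : ((∑ j ∈ range J, c j + 1 : ℕ) : ℝ) ≤ Fintype.card Z := by
      push_cast at hsum ⊢
      linarith
    exact_mod_cast this
  obtain ⟨ι⟩ := Function.Embedding.nonempty_of_card_le hT
  refine ⟨fun x => ι ⟨_, hmem x⟩, fun x => ?_⟩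
  set d := 2 ^ ℓ x with hd
  have hdpos : 0 < d := by positivity
  have hf : ∀ x', ι ⟨_, hmem x'⟩ = ι ⟨_, hmem x⟩ →
      ℓ x' = ℓ x ∧ R (ℓ x) x' / d = R (ℓ x) x / d := by
    intro x' h
    have := congrArg Subtype.val (ι.injective h)
    simp only [Sigma.mk.injEq, heq_eq_eq] at this
    exact ⟨this.1, by simpa [this.1] using this.2⟩
  -- Elements sharing a label have the same level and the same block, so their ranks lie in an
  -- interval of length d.
  calc #{x' | ι ⟨_, hmem x'⟩ = ι ⟨_, hmem x⟩}
      ≤ #(Ico (R (ℓ x) x / d * d) (R (ℓ x) x / d * d + d)) := by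
        refine card_le_card_of_injOn (R (ℓ x)) (fun x' hx' => ?_) fun x' hx' x'' hx'' h => ?_
        · have h := (hf x' (by simpa using hx')).2
          rw [← h]
          exact mem_coe.2 (mem_Ico.2 ⟨Nat.div_mul_le_self _ _, Nat.lt_div_mul_add hdpos⟩)
        · exact hRinj _ _ _ (hf x' (by simpa using hx')).1 (hf x'' (by simpa using hx'')).1 h
    _ = d := by simp

/-- The ceiling is 1 when ξ ≤ 1 and below ξ + 1 < 2ξ otherwise. -/
theorem natCeil_rpow_lt {ξ ρ : ℝ} (hξ : 0 < ξ) (hρ : 0 < ρ) :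
    (⌈ξ⌉₊ : ℝ) ^ ρ < 1 + (2 * ξ) ^ ρ := by
  have hpos : 0 < (2 * ξ) ^ ρ := Real.rpow_pos_of_pos (by linarith) _
  rcases le_or_gt ξ 1 with h | h
  · have : ⌈ξ⌉₊ = 1 := le_antisymm (Nat.ceil_le.2 (by simpa using h)) (Nat.ceil_pos.2 hξ)
    rw [this, Nat.cast_one, Real.one_rpow]
    linarith
  · have : (⌈ξ⌉₊ : ℝ) ≤ 2 * ξ := by linarith [Nat.ceil_lt_add_one hξ.le]
    linarith [Real.rpow_le_rpow (Nat.cast_nonneg _) this hρ.le]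

/-- Bunte–Lapidoth: a deterministic code whose lists are short for likely elements. -/
theorem exists_map_list_moment_le {X Z : Type*} [Fintype X] [Nonempty X] [Fintype Z]
    [DecidableEq Z] (p : X → ℝ) (hp : ∀ x, 0 ≤ p x) {ρ : ℝ} (hρ : 0 < ρ) {D : ℝ} (hD : 0 < D)
    (hZ : D + Real.logb 2 (Fintype.card X) + 2 ≤ Fintype.card Z) :
    ∃ f : X → Z, ∀ x,
      p x * (#{x' | f x' = f x} : ℝ) ^ ρ ≤
        p x + (4 / D * ∑ x', p x' ^ (1 / (1 + ρ))) ^ ρ * p x ^ (1 / (1 + ρ)) ∧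
      (0 < p x → p x * (#{x' | f x' = f x} : ℝ) ^ ρ <
        p x + (4 / D * ∑ x', p x' ^ (1 / (1 + ρ))) ^ ρ * p x ^ (1 / (1 + ρ))) := by
  classical
  have h1 : (0 : ℝ) < 1 + ρ := by linarith
  set a := 1 / (1 + ρ) with ha
  have ha0 : 0 < a := by positivity
  have hpa : ∀ x, 0 ≤ p x ^ a := fun x => Real.rpow_nonneg (hp x) _
  set A := ∑ x, p x ^ a
  have hA : 0 ≤ A := sum_nonneg fun x _ => hpa x
  have hApos : ∀ x, 0 < p x → 0 < A := fun x hx =>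
    sum_pos' (fun x _ => hpa x) ⟨x, mem_univ _, Real.rpow_pos_of_pos hx _⟩
  let J := Nat.clog 2 (Fintype.card X)
  -- Target list size. The factor 2 pays for rounding down to a power of two, so that ∑ 2^(-ℓ) ≤ D
  -- below level J; rounding up to an integer later doubles it again, giving the 4.
  let ξ : X → ℝ := fun x => 2 * A / D / p x ^ a
  have hξ : ∀ x, 0 < p x → 0 < ξ x := fun x hx => by
    have := hApos x hx
    have := Real.rpow_pos_of_pos hx a
    positivity
  -- Null elements go to level J, which is excluded from the sum of 2^(-ℓ).
  let ℓ : X → ℕ := fun x => if 0 < p x then min (Nat.log 2 ⌈ξ x⌉₊) J else J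
  have hJ : (J : ℝ) ≤ Real.logb 2 (Fintype.card X) + 1 := by
    have h : ⌈Real.logb 2 (Fintype.card X)⌉₊ = J := by
      simpa using Real.natCeil_logb_natCast 2 (Fintype.card X)
    rw [← h]
    refine (Nat.ceil_lt_add_one (Real.logb_nonneg (by norm_num) ?_)).le
    exact_mod_cast Fintype.card_pos
  have hlow : ∀ x, ℓ x < J → 0 < p x ∧ ((2 : ℝ) ^ ℓ x)⁻¹ ≤ D / A * p x ^ a := by
    intro x hx
    have hpx : 0 < p x := by
      by_contra h
      simp [ℓ, h] at hx
    refine ⟨hpx, ?_⟩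
    have hℓx : ℓ x = Nat.log 2 ⌈ξ x⌉₊ := by
      simp only [ℓ, hpx, if_true] at hx ⊢
      omega
    have h2 : ξ x ≤ 2 * 2 ^ ℓ x := by
      have : ⌈ξ x⌉₊ < 2 ^ (ℓ x + 1) := by
        rw [hℓx]
        exact Nat.lt_pow_succ_log_self (by norm_num) _
      calc ξ x ≤ ⌈ξ x⌉₊ := Nat.le_ceil _
        _ ≤ ((2 ^ (ℓ x + 1) : ℕ) : ℝ) := by exact_mod_cast this.le
        _ = 2 * 2 ^ ℓ x := by push_cast; ring
    have hAx := hApos x hpx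
    have hpax := Real.rpow_pos_of_pos hpx a
    have h3 : (D / A * p x ^ a)⁻¹ ≤ 2 ^ ℓ x := by
      have : ξ x = 2 * (D / A * p x ^ a)⁻¹ := by
        simp only [ξ]
        field_simp
      linarith
    exact inv_le_of_inv_le₀ (by positivity) h3
  have hsum : ∑ x with ℓ x < J, ((2 : ℝ) ^ ℓ x)⁻¹ ≤ D := by
    calc ∑ x with ℓ x < J, ((2 : ℝ) ^ ℓ x)⁻¹ ≤ ∑ x with ℓ x < J, D / A * p x ^ a :=
          sum_le_sum fun x hx => (hlow x (mem_filter.1 hx).2).2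
      _ ≤ ∑ x, D / A * p x ^ a :=
          sum_le_sum_of_subset_of_nonneg (subset_univ _) fun x _ _ =>
            mul_nonneg (div_nonneg hD.le hA) (hpa x)
      _ = D / A * A := by rw [← mul_sum]
      _ ≤ D := by
          rcases hA.eq_or_lt with h | h
          · rw [← h]; simpa using hD.le
          · rw [div_mul_cancel₀ _ h.ne']
  obtain ⟨f, hf⟩ := exists_map_card_fiber_le (Z := Z) J ℓ
    (fun x => by simp only [ℓ]; split_ifs <;> simp) (Nat.le_pow_clog (by norm_num) _)
    (by linarith)
  refine ⟨f, fun x => ?_⟩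
  have hstrict : 0 < p x → p x * (#{x' | f x' = f x} : ℝ) ^ ρ <
      p x + (4 / D * A) ^ ρ * p x ^ a := by
    intro hpx
    have hcard : #{x' | f x' = f x} ≤ ⌈ξ x⌉₊ := by
      refine (hf x).trans ?_
      have hle : ℓ x ≤ Nat.log 2 ⌈ξ x⌉₊ := by simp [ℓ, hpx]
      exact (Nat.pow_le_pow_right two_pos hle).trans
        (Nat.pow_log_le_self 2 (Nat.ceil_pos.2 (hξ x hpx)).ne')
    have hlt : (#{x' | f x' = f x} : ℝ) ^ ρ < 1 + (2 * ξ x) ^ ρ :=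
      (Real.rpow_le_rpow (Nat.cast_nonneg _) (by exact_mod_cast hcard) hρ.le).trans_lt
        (natCeil_rpow_lt (hξ x hpx) hρ)
    refine (mul_lt_mul_of_pos_left hlt hpx).trans_eq ?_
    have hpax := Real.rpow_pos_of_pos hpx a
    have e : 2 * ξ x = (4 / D * A) / p x ^ a := by
      simp only [ξ]
      ring
    have hsplit : p x = p x ^ a * (p x ^ a) ^ ρ := by
      rw [← Real.rpow_mul hpx.le, ← Real.rpow_add hpx]
      have : a + a * ρ = 1 := by rw [ha]; field_simp
      rw [this, Real.rpow_one]
    have hne := (Real.rpow_pos_of_pos hpax ρ).ne'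
    rw [e, Real.div_rpow (by positivity) hpax.le, mul_add, mul_one]
    congr 1
    nth_rewrite 1 [hsplit]
    field_simp
  rcases (hp x).eq_or_lt with h | h
  · refine ⟨?_, hstrict⟩
    rw [← h, Real.zero_rpow ha0.ne']
    simp
  · exact ⟨(hstrict h).le, hstrict⟩

/-! ### One-time-pad encoder -/

theorem sum_map_toReal_mul {U V : Type*} [Fintype U] [Fintype V] (p : PMF U) (g : U → V)
    (F : V → ℝ) : ∑ v, ((p.map g) v).toReal * F v = ∑ u, (p u).toReal * F (g u) := by
  classical
  have : ∀ v, ((p.map g) v).toReal = ∑ u, if v = g u then (p u).toReal else 0 := by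
    intro v
    rw [PMF.map_apply, tsum_fintype, ENNReal.toReal_sum]
    · refine sum_congr rfl fun u _ => ?_
      split_ifs <;> simp
    · intro u _
      split_ifs
      · exact p.apply_ne_top u
      · exact ENNReal.zero_ne_top
  simp_rw [this, sum_mul]
  rw [sum_comm]
  simp [ite_mul]

/-- The encoder that describes `(s, a, b) = f x y` by the hints `(s + u, a)` and `(u, b)`, where `u`
is a uniform one-time pad. -/
def padEncoder {X Y M₁ M₂ S A B : Type*} [Fintype S] [Nonempty S] [Add S] (f : X → Y → S × A × B)
    (e₁ : S × A ↪ M₁) (e₂ : S × B ↪ M₂) : Encoder X Y M₁ M₂ := fun x y =>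
  (PMF.uniformOfFintype S).map fun u => (e₁ ((f x y).1 + u, (f x y).2.1), e₂ (u, (f x y).2.2))

/-- The dependence of w on x is removed by summing over all of C; this costs the factor |C|. -/
theorem sum_inv_num_le_of_hint {X S C : Type*} [Fintype X] [Fintype S] [Fintype C]
    (g : S × C → GuessOrder X) (w : X → C) :
    ∑ x, ∑ s, ((g (s, w x)).num x : ℝ)⁻¹ ≤
      Fintype.card S * (Fintype.card C * (1 + Real.log (Fintype.card X))) := by
  calc ∑ x, ∑ s, ((g (s, w x)).num x : ℝ)⁻¹
      ≤ ∑ x, ∑ s, ∑ c, ((g (s, c)).num x : ℝ)⁻¹ :=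
        sum_le_sum fun x _ => sum_le_sum fun s _ =>
          single_le_sum (f := fun c => ((g (s, c)).num x : ℝ)⁻¹)
            (fun c _ => inv_nonneg.2 (Nat.cast_nonneg _)) (mem_univ (w x))
    _ = ∑ s, ∑ c, ∑ x, ((g (s, c)).num x : ℝ)⁻¹ := by
        rw [sum_comm]
        exact sum_congr rfl fun s _ => sum_comm
    _ ≤ ∑ _s : S, ∑ _c : C, (1 + Real.log (Fintype.card X)) :=
        sum_le_sum fun s _ => sum_le_sum fun c _ => (g (s, c)).sum_inv_num_le
    _ = _ := by simp only [sum_const, card_univ, nsmul_eq_mul]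

/-- The pads make each hint useless for the padded part, so that in total at most
`card A + card B` guessing orders are available to the guesser. -/
theorem sum_inv_min_num_le {X S A B : Type*} [Fintype X] [Fintype S] [AddGroup S] [Fintype A]
    [Fintype B] (v : X → S × A × B)
    (g₁ : S × A → GuessOrder X) (g₂ : S × B → GuessOrder X) :
    ∑ x, ∑ u, (min ((g₁ ((v x).1 + u, (v x).2.1)).num x : ℝ) ((g₂ (u, (v x).2.2)).num x))⁻¹ ≤
      Fintype.card S * ((Fintype.card A + Fintype.card B) *
        (1 + Real.log (Fintype.card X))) := by
  have hn : ∀ (g : GuessOrder X) x, 0 ≤ (g.num x : ℝ)⁻¹ := fun g x => by positivity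
  calc _ ≤ ∑ x, ∑ u, (((g₁ ((v x).1 + u, (v x).2.1)).num x : ℝ)⁻¹ +
        ((g₂ (u, (v x).2.2)).num x : ℝ)⁻¹) := by
        refine sum_le_sum fun x _ => sum_le_sum fun u _ => ?_
        rcases min_choice ((g₁ ((v x).1 + u, (v x).2.1)).num x : ℝ)
          ((g₂ (u, (v x).2.2)).num x) with h | h <;> rw [h]
        · exact le_add_of_nonneg_right (hn _ _)
        · exact le_add_of_nonneg_left (hn _ _)
    _ = ∑ x, ∑ s, ((g₁ (s, (v x).2.1)).num x : ℝ)⁻¹ +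
        ∑ x, ∑ u, ((g₂ (u, (v x).2.2)).num x : ℝ)⁻¹ := by
        simp_rw [sum_add_distrib]
        congr 1
        -- Translation by the secret permutes the pads, so the sum over u no longer sees the secret.
        exact sum_congr rfl fun x _ =>
          Equiv.sum_comp (Equiv.addLeft (v x).1) fun s => ((g₁ (s, (v x).2.1)).num x : ℝ)⁻¹
    _ ≤ _ :=
        (add_le_add (sum_inv_num_le_of_hint g₁ fun x => (v x).2.1)
          (sum_inv_num_le_of_hint g₂ fun x => (v x).2.2)).trans_eq (by ring)

section Direct

variable {X Y M₁ M₂ S A B : Type*} [Fintype S] [Nonempty S] [AddGroup S]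

/-- The second hint reveals u and b, the first then yields s and a by cancelling u. -/
theorem eq_of_padEncoder_jointProb_pos {P : PMF (X × Y)} {f : X → Y → S × A × B}
    {e₁ : S × A ↪ M₁} {e₂ : S × B ↪ M₂} {x x' : X} {y : Y} {m₁ : M₁} {m₂ : M₂}
    (h : 0 < jointProb P (padEncoder f e₁ e₂) x y m₁ m₂)
    (h' : 0 < jointProb P (padEncoder f e₁ e₂) x' y m₁ m₂) : f x y = f x' y := by
  have hsupp : ∀ x, 0 < jointProb P (padEncoder f e₁ e₂) x y m₁ m₂ →
      ∃ u, e₁ ((f x y).1 + u, (f x y).2.1) = m₁ ∧ e₂ (u, (f x y).2.2) = m₂ := by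
    intro x hx
    have hne : (padEncoder f e₁ e₂ x y) (m₁, m₂) ≠ 0 := fun h0 => by simp [jointProb, h0] at hx
    have hmem := (PMF.mem_support_iff _ _).2 hne
    rw [padEncoder, PMF.support_map] at hmem
    obtain ⟨u, -, hu⟩ := hmem
    exact ⟨u, congrArg Prod.fst hu, congrArg Prod.snd hu⟩
  obtain ⟨u, hu₁, hu₂⟩ := hsupp x h
  obtain ⟨u', hu'₁, hu'₂⟩ := hsupp x' h'
  have i₁ := e₁.injective (hu₁.trans hu'₁.symm)
  have i₂ := e₂.injective (hu₂.trans hu'₂.symm)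
  simp only [Prod.mk.injEq] at i₁ i₂
  obtain ⟨hu, hb⟩ := i₂
  subst hu
  exact Prod.ext (add_right_cancel i₁.1) (Prod.ext i₁.2 hb)

variable [Fintype X] [Fintype Y] [Fintype M₁] [Fintype M₂]

theorem bobListAmbiguity_padEncoder_le [DecidableEq S] [DecidableEq A] [DecidableEq B]
    (P : PMF (X × Y)) {ρ : ℝ} (hρ : 0 < ρ) (f : X → Y → S × A × B) (e₁ : S × A ↪ M₁)
    (e₂ : S × B ↪ M₂) :
    bobListAmbiguity P (padEncoder f e₁ e₂) ρ ≤
      ∑ x, ∑ y, (P (x, y)).toReal * (#{x' | f x' y = f x y} : ℝ) ^ ρ := by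
  rw [← expect_of_source P (padEncoder f e₁ e₂)]
  refine expect_mono P _ fun x y m₁ m₂ h => ?_
  refine Real.rpow_le_rpow (Nat.cast_nonneg _) (Nat.cast_le.2 (card_le_card fun x' hx' => ?_)) hρ.le
  have h' := (mem_bobList_iff P _ x' y m₁ m₂).1 hx'
  simpa using eq_of_padEncoder_jointProb_pos h' h

theorem expect_padEncoder (P : PMF (X × Y)) (f : X → Y → S × A × B) (e₁ : S × A ↪ M₁)
    (e₂ : S × B ↪ M₂) (F : X → Y → M₁ → M₂ → ℝ) :
    expect P (padEncoder f e₁ e₂) F =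
      ∑ y, ∑ x, (P (x, y)).toReal * ((Fintype.card S : ℝ)⁻¹ *
        ∑ u, F x y (e₁ ((f x y).1 + u, (f x y).2.1)) (e₂ (u, (f x y).2.2))) := by
  rw [expect, sum_comm]
  refine sum_congr rfl fun y _ => sum_congr rfl fun x _ => ?_
  have := sum_map_toReal_mul (PMF.uniformOfFintype S)
    (fun u => (e₁ ((f x y).1 + u, (f x y).2.1), e₂ (u, (f x y).2.2))) fun m => F x y m.1 m.2
  rw [Fintype.sum_prod_type] at this
  simp_rw [jointProb, mul_assoc, ← mul_sum]
  congr 1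
  refine this.trans ?_
  simp [mul_sum]

/-- Hölder over pairs (x, u), with weight p x independent of u. Both sides acquire a factor
|S|^(1+ρ), which cancels, so |S| is absent from the bound. -/
theorem guess_moment_padded_ge [Fintype A] [Fintype B] (p : X → ℝ) (hp : ∀ x, 0 ≤ p x) {ρ : ℝ}
    (hρ : 0 < ρ) (v : X → S × A × B) (g₁ : S × A → GuessOrder X) (g₂ : S × B → GuessOrder X) :
    (∑ x, p x ^ (1 / (1 + ρ))) ^ (1 + ρ) ≤
      (∑ x, p x * ((Fintype.card S : ℝ)⁻¹ *
        ∑ u, min ((g₁ ((v x).1 + u, (v x).2.1)).num x : ℝ) ((g₂ (u, (v x).2.2)).num x) ^ ρ)) *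
      ((Fintype.card A + Fintype.card B) * (1 + Real.log (Fintype.card X))) ^ ρ := by
  have hs : (0 : ℝ) < Fintype.card S := by exact_mod_cast Fintype.card_pos
  set s : ℝ := (Fintype.card S : ℝ)
  have hlog : 0 ≤ Real.log (Fintype.card X) := Real.log_natCast_nonneg _
  set C : ℝ := (Fintype.card A + Fintype.card B) * (1 + Real.log (Fintype.card X))
  have hC : 0 ≤ C := by positivity
  have h1 : (0 : ℝ) < 1 + ρ := by linarith
  let N : X × S → ℝ := fun z =>
    min ((g₁ ((v z.1).1 + z.2, (v z.1).2.1)).num z.1 : ℝ) ((g₂ (z.2, (v z.1).2.2)).num z.1)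
  have hN : ∀ z, 0 < N z := fun z => lt_min
    (Nat.cast_pos.2 (GuessOrder.one_le_num _ _)) (Nat.cast_pos.2 (GuessOrder.one_le_num _ _))
  have key := sum_rpow_rpow_le univ hρ (fun z : X × S => p z.1) N (fun z _ => hp _) fun z _ => hN z
  simp_rw [Fintype.sum_prod_type] at key
  simp only [sum_const, card_univ, nsmul_eq_mul] at key
  rw [← mul_sum, Real.mul_rpow hs.le (sum_nonneg fun x _ => Real.rpow_nonneg (hp x) _),
    Real.rpow_add hs, Real.rpow_one] at key
  have e : ∑ x, ∑ u, p x * N (x, u) ^ ρ = s * ∑ x, p x * (s⁻¹ * ∑ u, N (x, u) ^ ρ) := by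
    rw [mul_sum]
    refine sum_congr rfl fun x _ => ?_
    rw [← mul_sum]
    field_simp
  have hE : 0 ≤ ∑ x, p x * (s⁻¹ * ∑ u, N (x, u) ^ ρ) :=
    sum_nonneg fun x _ => mul_nonneg (hp x) (mul_nonneg (inv_nonneg.2 hs.le)
      (sum_nonneg fun u _ => Real.rpow_nonneg (hN _).le _))
  rw [e] at key
  have hinv : (∑ x, ∑ u, (N (x, u))⁻¹) ^ ρ ≤ s ^ ρ * C ^ ρ := by
    rw [← Real.mul_rpow hs.le hC]
    exact Real.rpow_le_rpow (sum_nonneg fun x _ => sum_nonneg fun u _ => (inv_pos.2 (hN _)).le)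
      (sum_inv_min_num_le v g₁ g₂) hρ.le
  have key' := key.trans (mul_le_mul_of_nonneg_left hinv (mul_nonneg hs.le hE))
  have hsρ : 0 < s * s ^ ρ := mul_pos hs (Real.rpow_pos_of_pos hs _)
  refine le_of_mul_le_mul_left (key'.trans_eq ?_) hsρ
  ring

theorem renyiSum_le_eveAmbiguity_padEncoder_mul [Fintype A] [Fintype B] (P : PMF (X × Y)) {ρ : ℝ}
    (hρ : 0 < ρ) (f : X → Y → S × A × B) (e₁ : S × A ↪ M₁) (e₂ : S × B ↪ M₂) :
    renyiSum P ρ ≤ eveAmbiguity P (padEncoder f e₁ e₂) ρ *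
      ((Fintype.card A + Fintype.card B) * (1 + Real.log (Fintype.card X))) ^ ρ := by
  obtain ⟨⟨G₁, G₂, hG⟩, -⟩ := exists_eveMoment_eq P (padEncoder f e₁ e₂) ρ
  rw [← hG, eveMoment, expect_padEncoder, sum_mul]
  refine sum_le_sum fun y _ => ?_
  simp_rw [min_rpow (Nat.cast_nonneg _) (Nat.cast_nonneg _) hρ.le]
  exact guess_moment_padded_ge (fun x => (P (x, y)).toReal) (fun _ => ENNReal.toReal_nonneg) hρ
    (fun x => f x y) (fun z => G₁ y (e₁ z)) fun z => G₂ y (e₂ z)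

end Direct

/-! ### Direct part and conclusion -/

theorem direct_bound {X Y M₁ M₂ : Type*} [Fintype X] [Fintype Y] [Fintype M₁] [Fintype M₂]
    (P : PMF (X × Y)) {ρ : ℝ} (hρ : 0 < ρ) {cs c₁ c₂ : ℕ} (h₁ : c₁ ≤ Fintype.card M₁ / cs)
    (h₂ : c₂ ≤ Fintype.card M₂ / cs)
    (hc : Real.logb 2 (Fintype.card X) + 2 < (cs : ℝ) * c₁ * c₂) :
    ∃ W : Encoder X Y M₁ M₂,
      bobListAmbiguity P W ρ <
        1 + (2 : ℝ) ^ (ρ * (condRenyiEntropy P (1 / (1 + ρ))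
          - Real.logb 2 ((cs : ℝ) * c₁ * c₂ - Real.logb 2 (Fintype.card X) - 2) + 2)) ∧
      (1 + Real.log (Fintype.card X)) ^ (-ρ) *
        (2 : ℝ) ^ (ρ * (condRenyiEntropy P (1 / (1 + ρ))
          - Real.logb 2 ((c₁ : ℝ) + c₂))) ≤ eveAmbiguity P W ρ := by
  have hX := card_pos_of_pmf P
  have : Nonempty X := Fintype.card_pos_iff.1 hX
  have hlogb : 0 ≤ Real.logb 2 (Fintype.card X) :=
    Real.logb_nonneg (by norm_num) (by exact_mod_cast hX)
  have hprod : 0 < cs * c₁ * c₂ := by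
    have : (0 : ℝ) < (cs : ℝ) * c₁ * c₂ := by linarith
    exact_mod_cast this
  have hcs : cs ≠ 0 := by rintro rfl; simp at hprod
  have hc₁ : 0 < c₁ := Nat.pos_of_ne_zero (by rintro rfl; simp at hprod)
  -- The pad group is `ZMod cs`, which is finite only for nonzero `cs`.
  have : NeZero cs := ⟨hcs⟩
  set D := (cs : ℝ) * c₁ * c₂ - Real.logb 2 (Fintype.card X) - 2 with hDdef
  have hD : 0 < D := by linarith
  have hcard : ∀ {c n : ℕ}, c ≤ n / cs → Fintype.card (ZMod cs × Fin c) ≤ n := by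
    intro c n h
    rw [Fintype.card_prod, ZMod.card, Fintype.card_fin, mul_comm]
    exact (Nat.mul_le_mul_right _ h).trans (Nat.div_mul_le_self _ _)
  obtain ⟨e₁⟩ := Function.Embedding.nonempty_of_card_le (hcard h₁)
  obtain ⟨e₂⟩ := Function.Embedding.nonempty_of_card_le (hcard h₂)
  choose f hf using fun y => exists_map_list_moment_le (Z := ZMod cs × Fin c₁ × Fin c₂)
    (fun x => (P (x, y)).toReal) (fun _ => ENNReal.toReal_nonneg) hρ hD (by
      simp only [Fintype.card_prod, ZMod.card, Fintype.card_fin]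
      push_cast
      rw [← mul_assoc]
      linarith)
  refine ⟨padEncoder (fun x y => f y x) e₁ e₂, ?_, ?_⟩
  · refine (bobListAmbiguity_padEncoder_le P hρ (fun x y => f y x) e₁ e₂).trans_lt ?_
    have hRHS : (2 : ℝ) ^ (ρ * (condRenyiEntropy P (1 / (1 + ρ)) - Real.logb 2 D + 2)) =
        ∑ x, ∑ y, (4 / D * ∑ x', (P (x', y)).toReal ^ (1 / (1 + ρ))) ^ ρ *
          (P (x, y)).toReal ^ (1 / (1 + ρ)) := by
      -- The +2 in the exponent is the factor 4 of the list-size bound.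
      have h4 : Real.logb 2 (D / 4) = Real.logb 2 D - 2 := by
        rw [Real.logb_div hD.ne' (by norm_num), show (4 : ℝ) = 2 ^ (2 : ℝ) by norm_num,
          Real.logb_rpow two_pos (by norm_num)]
      rw [show condRenyiEntropy P (1 / (1 + ρ)) - Real.logb 2 D + 2 =
        condRenyiEntropy P (1 / (1 + ρ)) - Real.logb 2 (D / 4) by rw [h4]; ring,
        two_rpow_mul_condRenyiEntropy_sub P hρ (by positivity), renyiSum, sum_div, sum_comm]
      refine sum_congr rfl fun y _ => ?_
      have hA : 0 ≤ ∑ x, (P (x, y)).toReal ^ (1 / (1 + ρ)) := sum_nonneg fun x _ => by positivity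
      rw [← mul_sum, Real.mul_rpow (by positivity) hA, Real.rpow_add_of_nonneg hA zero_le_one hρ.le,
        Real.rpow_one, div_eq_mul_inv, ← Real.inv_rpow (by positivity), inv_div]
      ring
    rw [hRHS]
    refine lt_of_lt_of_eq ?_ (congrArg (· + _) (sum_sum_toReal_eq_one P))
    simp_rw [← sum_add_distrib]
    -- One pair of positive probability makes the summed bound strict.
    obtain ⟨⟨x, y⟩, hxy⟩ := P.support_nonempty
    have hpos : 0 < (P (x, y)).toReal :=
      ENNReal.toReal_pos ((P.mem_support_iff _).1 hxy) (P.apply_ne_top _)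
    exact sum_lt_sum (fun x _ => sum_le_sum fun y _ => (hf y x).1) ⟨x, mem_univ _,
      sum_lt_sum (fun y _ => (hf y x).1) ⟨y, mem_univ _, (hf y x).2 hpos⟩⟩
  · have hlog : 0 ≤ Real.log (Fintype.card X) := Real.log_natCast_nonneg _
    have hc₁₂ : (0 : ℝ) < (c₁ : ℝ) + c₂ := by positivity
    have key := renyiSum_le_eveAmbiguity_padEncoder_mul P hρ (fun x y => f y x) e₁ e₂
    rw [Fintype.card_fin, Fintype.card_fin, Real.mul_rpow hc₁₂.le (by positivity), mul_comm (_ ^ ρ),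
      ← mul_assoc] at key
    rw [two_rpow_mul_condRenyiEntropy_sub P hρ hc₁₂, Real.rpow_neg (by positivity),
      inv_mul_le_iff₀ (by positivity), div_le_iff₀ (by positivity)]
    rwa [mul_comm (_ ^ ρ) (eveAmbiguity _ _ _)]

end DistStorage

end

theorem theorem2 {X Y M₁ M₂ : Type*} [Fintype X] [Fintype Y] [Fintype M₁] [Fintype M₂]
    (P : PMF (X × Y)) (ρ : ℝ) (hρ : 0 < ρ) :
    -- direct part
    (Real.logb 2 (Fintype.card X) + 2 < (Fintype.card M₁ : ℝ) * (Fintype.card M₂ : ℝ) →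
      ∀ cs c₁ c₂ : ℕ,
        cs ≤ min (Fintype.card M₁) (Fintype.card M₂) →
        c₁ ≤ Fintype.card M₁ / cs →
        c₂ ≤ Fintype.card M₂ / cs →
        Real.logb 2 (Fintype.card X) + 2 < (cs : ℝ) * c₁ * c₂ →
        ∃ W : DistStorage.Encoder X Y M₁ M₂,
          DistStorage.bobListAmbiguity P W ρ <
            1 + (2 : ℝ) ^ (ρ * (DistStorage.condRenyiEntropy P (1 / (1 + ρ))
              - Real.logb 2 ((cs : ℝ) * c₁ * c₂ - Real.logb 2 (Fintype.card X) - 2) + 2)) ∧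
          (1 + Real.log (Fintype.card X)) ^ (-ρ) *
            (2 : ℝ) ^ (ρ * (DistStorage.condRenyiEntropy P (1 / (1 + ρ))
              - Real.logb 2 ((c₁ : ℝ) + c₂))) ≤ DistStorage.eveAmbiguity P W ρ) ∧
    -- converse part
    (∀ W : DistStorage.Encoder X Y M₁ M₂,
      max ((2 : ℝ) ^ (ρ * (DistStorage.condRenyiEntropy P (1 / (1 + ρ))
          - Real.logb 2 ((Fintype.card M₁ : ℝ) * (Fintype.card M₂ : ℝ))))) 1
        ≤ DistStorage.bobListAmbiguity P W ρ ∧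
      DistStorage.eveAmbiguity P W ρ ≤
        min (min ((Fintype.card M₁ : ℝ) ^ ρ) ((Fintype.card M₂ : ℝ) ^ ρ)
            * DistStorage.bobListAmbiguity P W ρ)
          ((2 : ℝ) ^ (ρ * DistStorage.condRenyiEntropy P (1 / (1 + ρ))))) := by
  exact ⟨fun _ _ _ _ _ h₁ h₂ hc => DistStorage.direct_bound P hρ h₁ h₂ hc,
    fun W => DistStorage.converse_bound P hρ W⟩
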